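/- For a finite simple graph $G$, a set $S\subseteq V(G)$ with $|S|\ge 2$, an $S$-Steiner tree is a subgraph of $G$ that is a tree and contains every vertex of $S$. Let $\lambda(S)$ be the maximum number of pairwise edge-disjoint $S$-Steiner trees in $G$, and for $2\le k\le |V(G)|$ let the generalized $k$-edge-connectivity of $G$ be $\lambda_k(G)=\min\{\lambda(S) : S\subseteq V(G),\ |S|=k\}$. The total graph $T(G)$ has vertex set $V(G)\cup E(G)$ (disjoint union); two of its vertices are adjacent if they are adjacent vertices of $G$, or two distinct edges of $G$ with a common end, or a vertex and an edge of $G$ that are incident. **Theorem.** Let $n\ge 2$ and let $K_n$ be the complete graph on $n$ vertices. Then $\lambda_3(T(K_n))=2n-3$. -/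

import Mathlib

namespace SimpleGraph

/-- The total graph of `G`: its vertices are the vertices and the edges of `G`; two of them are
adjacent when they are adjacent vertices of `G`, or two distinct edges of `G` with a common end,
or a vertex and an edge of `G` that are incident. -/
def totalGraph {V : Type*} (G : SimpleGraph V) : SimpleGraph (V ⊕ G.edgeSet) where
  Adj
    | .inl u, .inl v => G.Adj u v
    | .inr e, .inr f => G.lineGraph.Adj e f
    | .inl v, .inr e => v ∈ (e : Sym2 V)
    | .inr e, .inl v => v ∈ (e : Sym2 V)
  symm := ⟨by
    rintro (u | e) (v | f) h
    · exact G.adj_symm h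
    · exact h
    · exact h
    · exact G.lineGraph.adj_symm h⟩
  loopless := ⟨by
    rintro (v | e) h
    · exact G.irrefl h
    · exact G.lineGraph.irrefl h⟩

/-- `T` is an `S`-Steiner tree: a subgraph of `G` that is a tree and contains all vertices
of `S`. -/
def IsSteinerTree {V : Type*} (G : SimpleGraph V) (S : Finset V) (T : G.Subgraph) : Prop :=
  T.coe.IsTree ∧ (S : Set V) ⊆ T.verts

/-- There are `m` pairwise edge-disjoint `S`-Steiner trees in `G`. -/
def HasEdgeDisjointSteinerTrees {V : Type*} (G : SimpleGraph V) (S : Finset V) (m : ℕ) : Prop :=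
  ∃ T : Fin m → G.Subgraph, (∀ i, G.IsSteinerTree S (T i)) ∧
    ∀ i j, i ≠ j → Disjoint (T i).edgeSet (T j).edgeSet

/-- The generalized local edge-connectivity `λ(S)`, for `S` with at least two vertices: the maximum
number of pairwise edge-disjoint `S`-Steiner trees. The supremum is taken in `ℕ∞`, so that an
unbounded family would give `⊤`. -/
noncomputable def localSteinerEdgeConnectivity {V : Type*} (G : SimpleGraph V) (S : Finset V) :
    ℕ∞ :=
  ⨆ (m : ℕ) (_ : G.HasEdgeDisjointSteinerTrees S m), (m : ℕ∞)

/-- The generalized `k`-edge-connectivity `λ_k(G)`, for `2 ≤ k` and at least `k` vertices: the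
minimum of `λ(S)` over all sets `S` of exactly `k` vertices (and `⊤` if there are none). -/
noncomputable def generalizedEdgeConnectivity {V : Type*} (G : SimpleGraph V) (k : ℕ) : ℕ∞ :=
  ⨅ (S : Finset V) (_ : S.card = k), G.localSteinerEdgeConnectivity S

end SimpleGraph

/-! Add a point ∞ to the vertices and read a vertex v as the pair {∞, v}: this identifies T(K_n)
with the line graph of K_N, N = n + 1 (`totalPair`), where the value to prove is 2N - 5.

Lower bound (`hasPairWalks`): three edges of K_N form a triangle, a star, a path, a path of length
two plus a disjoint edge, or a matching. They span k = 3, 4, 4, 5 or 6 points, and on these points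
2k - 5 edge-disjoint walks through the three edges are written down. Each further point x gives two
more walks, every step of which has an end containing x, so they share no step with walks avoiding x
(`hasPairWalks_of_extension`). Walks may backtrack, since only a spanning tree of each is used.

Upper bound (`HasEdgeDisjointSteinerTrees.lt_of_adj`): let S contain two vertices u, v of K_n and a
third element. Both have degree at most 2(n - 1) in T(K_n). With that many trees, each would use
exactly one edge at u and one at v, and the tree containing uv could not reach the third element. -/

namespace SimpleGraph

/-! ### Steiner trees from walks, and the degree bound -/

section General

variable {V V' : Type*}

/-- A connected subgraph containing `S` has a spanning tree, which is an `S`-Steiner tree. -/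
theorem Subgraph.exists_isSteinerTree_le {G : SimpleGraph V} {S : Finset V} (H : G.Subgraph)
    (hH : H.Connected) (hS : (S : Set V) ⊆ H.verts) :
    ∃ T : G.Subgraph, G.IsSteinerTree S T ∧ T ≤ H := by
  obtain ⟨T, hT, htree⟩ := hH.coe.exists_isTree_le
  let T' : G.Subgraph :=
    { verts := H.verts
      Adj := fun u v => ∃ (hu : u ∈ H.verts) (hv : v ∈ H.verts), T.Adj ⟨u, hu⟩ ⟨v, hv⟩
      adj_sub := by
        rintro u v ⟨hu, hv, h⟩
        exact H.adj_sub (hT h)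
      edge_vert := by
        rintro u v ⟨hu, -, -⟩
        exact hu
      symm := ⟨by
        rintro u v ⟨hu, hv, h⟩
        exact ⟨hv, hu, h.symm⟩⟩ }
  have hcoe : T'.coe = T := by
    ext u v
    exact ⟨fun ⟨_, _, h⟩ => h, fun h => ⟨u.2, v.2, h⟩⟩
  refine ⟨T', ⟨hcoe ▸ htree, hS⟩, le_rfl, ?_⟩
  rintro u v ⟨hu, hv, h⟩
  exact hT h

/-- The unordered pairs of consecutive entries of a list. -/
def consecutivePairs (l : List V) : List (Sym2 V) :=
  List.zipWith (s(·, ·)) l l.tail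

theorem consecutivePairs_map (f : V → V') (l : List V) :
    consecutivePairs (l.map f) = (consecutivePairs l).map (Sym2.map f) := by
  simp [consecutivePairs, List.zipWith_map, List.map_zipWith, ← List.map_tail]

theorem mem_of_mem_consecutivePairs {l : List V} {e : Sym2 V} (he : e ∈ consecutivePairs l)
    {v : V} (hv : v ∈ e) : v ∈ l := by
  obtain ⟨i, hi, rfl⟩ := List.mem_iff_getElem.1 he
  simp only [consecutivePairs, List.getElem_zipWith, Sym2.mem_iff] at hv
  rcases hv with rfl | rfl
  · exact List.getElem_mem _
  · exact List.mem_of_mem_tail (List.getElem_mem _)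

/-- No pair is consecutive in both lists. -/
def PairDisjoint (l l' : List V) : Prop :=
  ∀ e ∈ consecutivePairs l, e ∉ consecutivePairs l'

theorem pairDisjoint_map {f : V → V'} (hf : f.Injective) {l l' : List V} :
    PairDisjoint (l.map f) (l'.map f) ↔ PairDisjoint l l' := by
  simp only [PairDisjoint, consecutivePairs_map, List.mem_map, forall_exists_index, and_imp,
    forall_apply_eq_imp_iff₂, not_exists, not_and]
  exact ⟨fun h e he he' => h e he e he' rfl,
    fun h e he e' he' hee => h e he (Sym2.map.injective hf hee ▸ he')⟩

/-- Pairwise edge-disjoint walks through all vertices of `S` give edge-disjoint Steiner trees. -/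
theorem hasEdgeDisjointSteinerTrees_of_walks {G : SimpleGraph V} {S : Finset V}
    (hS : S.Nonempty) (W : List (List V)) (hchain : ∀ l ∈ W, l.IsChain G.Adj)
    (hmem : ∀ l ∈ W, ∀ s ∈ S, s ∈ l) (hdisj : W.Pairwise PairDisjoint) :
    G.HasEdgeDisjointSteinerTrees S W.length := by
  have key : ∀ i : Fin W.length, ∃ T : G.Subgraph, G.IsSteinerTree S T ∧
      ∀ e ∈ T.edgeSet, e ∈ consecutivePairs W[i] := by
    intro i
    have hi : W[i] ∈ W := List.getElem_mem _
    obtain ⟨s, hs⟩ := hS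
    have hne : W[i] ≠ [] := List.ne_nil_of_mem (hmem _ hi s hs)
    let p := Walk.ofSupport W[i] hne (hchain _ hi)
    have hp : p.support = W[i] := Walk.support_ofSupport hne (hchain _ hi)
    obtain ⟨T, hT, hle⟩ := p.toSubgraph.exists_isSteinerTree_le (S := S) p.toSubgraph_connected
      (fun s hs => by
        rw [Walk.mem_verts_toSubgraph, hp]
        exact hmem _ hi s hs)
    refine ⟨T, hT, fun e he => ?_⟩
    have := Subgraph.edgeSet_mono hle he
    rwa [Walk.mem_edges_toSubgraph, Walk.edges_eq_zipWith_support, hp] at this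
  choose T hT hTW using key
  refine ⟨T, hT, fun i j hij => Set.disjoint_left.2 fun e hi hj => ?_⟩
  have hW := List.pairwise_iff_getElem.1 hdisj
  rcases lt_or_gt_of_ne (Fin.val_ne_of_ne hij) with h | h
  · exact hW i j i.2 j.2 h e (hTW i e hi) (hTW j e hj)
  · exact hW j i j.2 i.2 h e (hTW j e hj) (hTW i e hi)

/-- If two adjacent vertices of `S` have degree at most `d`, and `S` has a third vertex, then
there are fewer than `d` edge-disjoint `S`-Steiner trees. -/
theorem HasEdgeDisjointSteinerTrees.lt_of_adj {G : SimpleGraph V} {S : Finset V} {m d : ℕ}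
    (h : G.HasEdgeDisjointSteinerTrees S m) {a b c : V} (ha : a ∈ S) (hb : b ∈ S) (hc : c ∈ S)
    (hab : G.Adj a b) (hca : c ≠ a) (hcb : c ≠ b) {A B : Finset V}
    (hA : ∀ w, G.Adj a w → w ∈ A) (hB : ∀ w, G.Adj b w → w ∈ B)
    (hAd : A.card ≤ d) (hBd : B.card ≤ d) : m < d := by
  classical
  obtain ⟨T, hT, hdisj⟩ := h
  by_contra! hm
  have huniq : ∀ i j u v, (T i).Adj u v → (T j).Adj u v → i = j := by
    intro i j u v hi hj
    by_contra hij
    exact Set.disjoint_left.1 (hdisj i j hij) (show s(u, v) ∈ (T i).edgeSet from hi) hj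
  -- Each tree has an edge at x, and these edges are distinct. Since d ≤ m, they exhaust the at most
  -- d edges at x, so each tree has exactly one.
  have key : ∀ x ∈ S, ∀ y ∈ S, x ≠ y → ∀ N : Finset V, (∀ w, G.Adj x w → w ∈ N) → N.card ≤ d →
      (∀ w, G.Adj x w → ∃ i, (T i).Adj x w) ∧
      ∀ i v w, (T i).Adj x v → (T i).Adj x w → v = w := by
    intro x hx y hy hxy N hN hNd
    have hnbr : ∀ i, ∃ w, (T i).Adj x w := by
      intro i
      have hconn := (hT i).1.1.preconnected
      have hx' : x ∈ (T i).verts := (hT i).2 hx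
      have hy' : y ∈ (T i).verts := (hT i).2 hy
      have : Nontrivial (T i).verts := ⟨⟨x, hx'⟩, ⟨y, hy'⟩, by simpa using hxy⟩
      obtain ⟨w, hw⟩ := hconn.exists_adj_of_nontrivial ⟨x, hx'⟩
      exact ⟨w, hw⟩
    choose g hg using hnbr
    have hinj : g.Injective := fun i j hij => huniq i j x (g i) (hg i) (hij ▸ hg j)
    have hsub : Finset.univ.image g ⊆ N := by
      intro w hw
      obtain ⟨i, -, rfl⟩ := Finset.mem_image.1 hw
      exact hN _ ((T i).adj_sub (hg i))
    have heq : Finset.univ.image g = N := by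
      apply Finset.eq_of_subset_of_card_le hsub
      rw [Finset.card_image_of_injective _ hinj, Finset.card_univ, Fintype.card_fin]
      exact hNd.trans hm
    have hsurj : ∀ w, G.Adj x w → ∃ i, g i = w := by
      intro w hw
      have := hN w hw
      rw [← heq] at this
      simpa using this
    have honly : ∀ i v, (T i).Adj x v → v = g i := by
      intro i v hv
      obtain ⟨j, rfl⟩ := hsurj v ((T i).adj_sub hv)
      rw [huniq i j _ _ hv (hg j)]
    refine ⟨fun w hw => ?_, fun i v w hv hw => (honly i v hv).trans (honly i w hw).symm⟩
    obtain ⟨i, rfl⟩ := hsurj w hw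
    exact ⟨i, hg i⟩
  obtain ⟨hex, hax⟩ := key a ha c hc hca.symm A hA hAd
  obtain ⟨-, hbx⟩ := key b hb c hc hcb.symm B hB hBd
  obtain ⟨i, hi⟩ := hex b hab
  -- In the tree containing ab, neither a nor b has another neighbour, so {a, b} is a whole
  -- component.
  have hclosed : ∀ u v : (T i).verts, (T i).coe.Reachable u v →
      ((u : V) = a ∨ (u : V) = b) → ((v : V) = a ∨ (v : V) = b) := by
    rintro u v ⟨p⟩
    induction p with
    | nil => exact id
    | cons hadj _ ih =>
      intro hu
      apply ih
      rw [Subgraph.coe_adj] at hadj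
      rcases hu with hu | hu
      · rw [hu] at hadj
        exact Or.inr (hax i _ _ hadj hi)
      · rw [hu] at hadj
        exact Or.inl (hbx i _ _ hadj hi.symm)
  have := hclosed ⟨a, (hT i).2 ha⟩ ⟨c, (hT i).2 hc⟩ ((hT i).1.1.preconnected _ _) (Or.inl rfl)
  exact this.elim hca hcb

end General

/-! ### Walks in the line graph of a complete graph -/

/-- Two unordered pairs are adjacent when they are distinct and share an element. -/
def pairGraph (α : Type*) : SimpleGraph (Sym2 α) where
  Adj e f := e ≠ f ∧ ∃ a ∈ e, a ∈ f
  symm := ⟨fun _ _ ⟨hne, a, ha, ha'⟩ => ⟨hne.symm, a, ha', ha⟩⟩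
  loopless := ⟨fun _ h => h.1 rfl⟩

/-- The decidability instances allow the explicit walks to be checked by `decide`. -/
instance (α : Type*) [DecidableEq α] [Fintype α] : DecidableRel (pairGraph α).Adj :=
  fun e f => inferInstanceAs (Decidable (e ≠ f ∧ ∃ a, a ∈ e ∧ a ∈ f))

/-- A walk of the line graph of a complete graph that passes through all of `S`. -/
def IsPairWalk {α : Type*} (S : List (Sym2 α)) (l : List (Sym2 α)) : Prop :=
  l.IsChain (pairGraph α).Adj ∧ (∀ s ∈ S, s ∈ l) ∧ ∀ v ∈ l, ¬ v.IsDiag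

instance {α : Type*} [DecidableEq α] [Fintype α] (S l : List (Sym2 α)) :
    Decidable (IsPairWalk S l) := by
  unfold IsPairWalk; infer_instance

instance {V : Type*} [DecidableEq V] (l l' : List V) : Decidable (PairDisjoint l l') := by
  unfold PairDisjoint; infer_instance

/-- There are `m` pairwise edge-disjoint walks through all of `S`. -/
def HasPairWalks {α : Type*} (S : List (Sym2 α)) (m : ℕ) : Prop :=
  ∃ W : List (List (Sym2 α)), W.length = m ∧ (∀ l ∈ W, IsPairWalk S l) ∧ W.Pairwise PairDisjoint

theorem IsPairWalk.map {α β : Type*} {f : α → β} (hf : f.Injective) {S l : List (Sym2 α)}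
    (h : IsPairWalk S l) : IsPairWalk (S.map (Sym2.map f)) (l.map (Sym2.map f)) := by
  refine ⟨List.isChain_map_of_isChain _ ?_ h.1, ?_, ?_⟩
  · rintro e e' ⟨hne, a, ha, ha'⟩
    exact ⟨(Sym2.map.injective hf).ne hne, f a, Sym2.mem_map.2 ⟨a, ha, rfl⟩,
      Sym2.mem_map.2 ⟨a, ha', rfl⟩⟩
  · intro s hs
    obtain ⟨t, ht, rfl⟩ := List.mem_map.1 hs
    exact List.mem_map_of_mem (h.2.1 t ht)
  · intro s hs
    obtain ⟨t, ht, rfl⟩ := List.mem_map.1 hs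
    rw [Sym2.isDiag_map hf]
    exact h.2.2 t ht

/-- Walks for `S` inside `Fin k`, together with two walks that use one additional element in each
of their steps, extend to walks inside any larger set, two for each additional element. -/
theorem hasPairWalks_of_extension {k : ℕ} {S : List (Sym2 (Fin k))} {W : List (List (Sym2 (Fin k)))}
    (hW : ∀ l ∈ W, IsPairWalk S l) (hWd : W.Pairwise PairDisjoint)
    {p q : List (Sym2 (Fin (k + 1)))} (hp : IsPairWalk (S.map (Sym2.map Fin.succ)) p)
    (hq : IsPairWalk (S.map (Sym2.map Fin.succ)) q) (hpq : PairDisjoint p q)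
    (hp0 : ∀ e ∈ consecutivePairs p, ∃ v ∈ e, 0 ∈ v)
    (hq0 : ∀ e ∈ consecutivePairs q, ∃ v ∈ e, 0 ∈ v)
    {α : Type*} [Fintype α] {f : Fin k → α} (hf : f.Injective) :
    HasPairWalks (S.map (Sym2.map f)) (W.length + 2 * (Fintype.card α - k)) := by
  classical
  -- Induction on the set of additional points. The last clause confines the walks to the points
  -- used so far, which makes steps through a new point new.
  have main : ∀ X : Finset α, (∀ x ∈ X, x ∉ Set.range f) →
      ∃ W' : List (List (Sym2 α)), W'.length = W.length + 2 * X.card ∧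
        (∀ l ∈ W', IsPairWalk (S.map (Sym2.map f)) l) ∧ W'.Pairwise PairDisjoint ∧
        ∀ l ∈ W', ∀ v ∈ l, ∀ a ∈ v, a ∈ Set.range f ∨ a ∈ X := by
    intro X
    induction X using Finset.induction_on with
    | empty =>
      intro _
      refine ⟨W.map (List.map (Sym2.map f)), by simp, ?_, ?_, ?_⟩
      · intro l hl
        obtain ⟨l', hl', rfl⟩ := List.mem_map.1 hl
        exact (hW l' hl').map hf
      · exact List.pairwise_map.2
          (hWd.imp fun h => (pairDisjoint_map (Sym2.map.injective hf)).2 h)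
      · intro l hl v hv a ha
        obtain ⟨l', -, rfl⟩ := List.mem_map.1 hl
        obtain ⟨v', -, rfl⟩ := List.mem_map.1 hv
        obtain ⟨b, -, rfl⟩ := Sym2.mem_map.1 ha
        exact Or.inl ⟨b, rfl⟩
    | insert x X hx ih =>
      intro hX
      obtain ⟨W', hlen, hwalk, hdisj, hsupp⟩ := ih fun y hy => hX y (Finset.mem_insert_of_mem hy)
      have hxf : x ∉ Set.range f := hX x (Finset.mem_insert_self x X)
      -- In `p` and `q` the label 0 is the additional point and i + 1 stands for the old label i.
      let g : Fin (k + 1) → α := Fin.cons x f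
      have hg : g.Injective := Fin.cons_injective_iff.2 ⟨hxf, hf⟩
      have hgS : (S.map (Sym2.map Fin.succ)).map (Sym2.map g) = S.map (Sym2.map f) := by
        rw [List.map_map, Sym2.map_comp.symm]
        rfl
      have hgsupp : ∀ r : List (Sym2 (Fin (k + 1))), ∀ v ∈ r.map (Sym2.map g), ∀ a ∈ v,
          a ∈ Set.range f ∨ a ∈ insert x X := by
        intro r v hv a ha
        obtain ⟨v', -, rfl⟩ := List.mem_map.1 hv
        obtain ⟨b, -, rfl⟩ := Sym2.mem_map.1 ha
        refine Fin.cases ?_ (fun i => ?_) b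
        · exact Or.inr (Finset.mem_insert_self x X)
        · exact Or.inl ⟨i, rfl⟩
      have hnew : ∀ r : List (Sym2 (Fin (k + 1))), (∀ e ∈ consecutivePairs r, ∃ v ∈ e, 0 ∈ v) →
          ∀ l ∈ W', PairDisjoint (r.map (Sym2.map g)) l := by
        intro r hr l hl e he hel
        rw [consecutivePairs_map] at he
        obtain ⟨e', he', rfl⟩ := List.mem_map.1 he
        obtain ⟨v, hv, h0⟩ := hr e' he'
        have hvl := mem_of_mem_consecutivePairs hel (Sym2.mem_map.2 ⟨v, hv, rfl⟩)
        exact (hsupp l hl _ hvl x (Sym2.mem_map.2 ⟨0, h0, rfl⟩)).elim hxf hx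
      refine ⟨p.map (Sym2.map g) :: q.map (Sym2.map g) :: W', ?_, ?_, ?_, ?_⟩
      · rw [List.length_cons, List.length_cons, hlen, Finset.card_insert_of_notMem hx]
        ring
      · simp only [List.forall_mem_cons]
        exact ⟨hgS ▸ hp.map hg, hgS ▸ hq.map hg, hwalk⟩
      · simp only [List.pairwise_cons, List.forall_mem_cons]
        exact ⟨⟨(pairDisjoint_map (Sym2.map.injective hg)).2 hpq, hnew p hp0⟩, hnew q hq0, hdisj⟩
      · simp only [List.forall_mem_cons]
        exact ⟨hgsupp p, hgsupp q, fun l hl v hv a ha =>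
          (hsupp l hl v hv a ha).imp_right Finset.mem_insert_of_mem⟩
  obtain ⟨W', hlen, hwalk, hdisj, -⟩ := main (Finset.univ.image f)ᶜ (by simp)
  refine ⟨W', ?_, hwalk, hdisj⟩
  rw [hlen, Finset.card_compl, Finset.card_image_of_injective _ hf, Finset.card_univ,
    Fintype.card_fin]

/-! ### Explicit walks for the five configurations -/

/-- Walks through the three edges of a triangle. -/
theorem hasPairWalks_triangle {α : Type*} [Fintype α] {a b c : α}
    (h : List.Nodup [a, b, c]) :
    HasPairWalks [s(a, b), s(b, c), s(a, c)] (1 + 2 * (Fintype.card α - 3)) := by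
  have hf : Function.Injective ![a, b, c] := List.nodup_ofFn.1 (by simpa using h)
  exact hasPairWalks_of_extension (k := 3) (S := [s(0, 1), s(1, 2), s(0, 2)])
    (W := [[s(0, 1), s(1, 2), s(0, 2)]])
    (p := [s(1, 3), s(0, 1), s(1, 2), s(0, 1), s(0, 2), s(2, 3)])
    (q := [s(1, 3), s(0, 3), s(2, 3), s(0, 3), s(0, 2), s(1, 2)])
    (by decide) (by decide) (by decide) (by decide) (by decide) (by decide) (by decide) hf

set_option maxRecDepth 20000 in
/-- Walks through three edges with a common end. -/
theorem hasPairWalks_star {α : Type*} [Fintype α] {a b c d : α}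
    (h : List.Nodup [a, b, c, d]) :
    HasPairWalks [s(a, b), s(a, c), s(a, d)] (3 + 2 * (Fintype.card α - 4)) := by
  have hf : Function.Injective ![a, b, c, d] := List.nodup_ofFn.1 (by simpa using h)
  exact hasPairWalks_of_extension (k := 4) (S := [s(0, 1), s(0, 2), s(0, 3)])
    (W := [[s(0, 1), s(0, 2), s(0, 3)],
        [s(0, 3), s(0, 1), s(1, 2), s(0, 2)],
        [s(0, 1), s(1, 3), s(0, 3), s(1, 3), s(2, 3), s(0, 2)]])
    (p := [s(1, 2), s(0, 1), s(1, 3), s(0, 1), s(1, 4)])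
    (q := [s(1, 2), s(0, 2), s(0, 3), s(1, 3), s(0, 3), s(0, 4), s(1, 4)])
    (by decide) (by decide) (by decide) (by decide) (by decide) (by decide) (by decide) hf

set_option maxRecDepth 20000 in
/-- Walks through the three edges of a path. -/
theorem hasPairWalks_path {α : Type*} [Fintype α] {a b c d : α}
    (h : List.Nodup [a, b, c, d]) :
    HasPairWalks [s(a, b), s(b, c), s(c, d)] (3 + 2 * (Fintype.card α - 4)) := by
  have hf : Function.Injective ![a, b, c, d] := List.nodup_ofFn.1 (by simpa using h)
  exact hasPairWalks_of_extension (k := 4) (S := [s(0, 1), s(1, 2), s(2, 3)])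
    (W := [[s(0, 1), s(1, 2), s(2, 3)],
        [s(0, 1), s(0, 2), s(1, 2), s(0, 2), s(2, 3)],
        [s(0, 1), s(1, 3), s(1, 2), s(1, 3), s(2, 3)]])
    (p := [s(1, 2), s(0, 2), s(2, 3), s(0, 2), s(0, 3), s(3, 4)])
    (q := [s(1, 2), s(0, 1), s(0, 4), s(3, 4), s(0, 4), s(0, 3), s(2, 3)])
    (by decide) (by decide) (by decide) (by decide) (by decide) (by decide) (by decide) hf

set_option maxRecDepth 20000 in
/-- Walks through two edges with a common end and an edge disjoint from them. -/
theorem hasPairWalks_path_add_edge {α : Type*} [Fintype α] {a b c d e : α}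
    (h : List.Nodup [a, b, c, d, e]) :
    HasPairWalks [s(a, b), s(b, c), s(d, e)] (5 + 2 * (Fintype.card α - 5)) := by
  have hf : Function.Injective ![a, b, c, d, e] := List.nodup_ofFn.1 (by simpa using h)
  exact hasPairWalks_of_extension (k := 5) (S := [s(0, 1), s(1, 2), s(3, 4)])
    (W := [[s(0, 1), s(1, 3), s(1, 2), s(1, 3), s(3, 4)],
        [s(0, 1), s(1, 4), s(1, 2), s(1, 4), s(3, 4)],
        [s(0, 1), s(0, 3), s(3, 4), s(0, 3), s(2, 3), s(1, 2)],
        [s(0, 1), s(0, 4), s(3, 4), s(0, 4), s(2, 4), s(1, 2)],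
        [s(0, 1), s(0, 2), s(1, 2), s(0, 2), s(2, 3), s(3, 4)]])
    (p := [s(1, 2), s(0, 2), s(2, 3), s(0, 2), s(0, 4), s(4, 5)])
    (q := [s(1, 2), s(0, 1), s(0, 3), s(2, 3), s(0, 3), s(0, 5), s(4, 5)])
    (by decide) (by decide) (by decide) (by decide) (by decide) (by decide) (by decide) hf

set_option maxRecDepth 20000 in
/-- Walks through three pairwise disjoint edges. -/
theorem hasPairWalks_matching {α : Type*} [Fintype α] {a b c d e f : α}
    (h : List.Nodup [a, b, c, d, e, f]) :
    HasPairWalks [s(a, b), s(c, d), s(e, f)] (7 + 2 * (Fintype.card α - 6)) := by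
  have hf : Function.Injective ![a, b, c, d, e, f] := List.nodup_ofFn.1 (by simpa using h)
  exact hasPairWalks_of_extension (k := 6) (S := [s(0, 1), s(2, 3), s(4, 5)])
    (W := [[s(0, 1), s(0, 2), s(2, 3), s(0, 2), s(2, 4), s(4, 5)],
        [s(0, 1), s(1, 3), s(2, 3), s(1, 3), s(3, 5), s(4, 5)],
        [s(0, 1), s(0, 3), s(2, 3), s(0, 3), s(0, 4), s(4, 5)],
        [s(2, 3), s(2, 5), s(4, 5), s(2, 5), s(1, 2), s(0, 1)],
        [s(2, 3), s(3, 4), s(4, 5), s(3, 4), s(0, 4), s(0, 1)],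
        [s(0, 1), s(0, 5), s(4, 5), s(0, 5), s(3, 5), s(2, 3)],
        [s(0, 1), s(1, 4), s(4, 5), s(1, 4), s(2, 4), s(2, 3)]])
    (p := [s(1, 2), s(0, 1), s(0, 3), s(3, 4), s(0, 3), s(0, 5), s(5, 6)])
    (q := [s(1, 2), s(0, 2), s(0, 4), s(3, 4), s(0, 4), s(0, 6), s(5, 6)])
    (by decide) (by decide) (by decide) (by decide) (by decide) (by decide) (by decide) hf

/-- Only membership in the list matters; this is used to reorder the three pairs. -/
theorem HasPairWalks.congr {α : Type*} {S S' : List (Sym2 α)} {m : ℕ} (h : HasPairWalks S m)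
    (hS : ∀ s ∈ S', s ∈ S) : HasPairWalks S' m := by
  obtain ⟨W, hlen, hwalk, hdisj⟩ := h
  exact ⟨W, hlen, fun l hl => ⟨(hwalk l hl).1, fun s hs => (hwalk l hl).2.1 s (hS s hs),
    (hwalk l hl).2.2⟩, hdisj⟩

/-! ### Classification of three edges -/

section Classification

variable {α : Type*} [Fintype α]

theorem card_le_of_nodup {l : List α} (h : l.Nodup) : l.length ≤ Fintype.card α := by
  classical
  rw [← List.toFinset_card_of_nodup h]
  exact Finset.card_le_univ _

/-- The configuration depends on how `e` meets {a, b, c}: both ends inside give a triangle; exactly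
one inside gives a star if it is a and a path if it is b or c; none inside gives a path plus an
edge. -/
theorem hasPairWalks_of_common_end {a b c : α} {e : Sym2 α} (hab : a ≠ b) (hac : a ≠ c)
    (hbc : b ≠ c) (he : ¬ e.IsDiag) (h1 : e ≠ s(a, b)) (h2 : e ≠ s(a, c)) :
    HasPairWalks [s(a, b), s(a, c), e] (2 * Fintype.card α - 5) := by
  have path : ∀ {b c p : α}, a ≠ b → a ≠ c → b ≠ c → p ≠ a → p ≠ b → p ≠ c →
      HasPairWalks [s(a, b), s(a, c), s(b, p)] (2 * Fintype.card α - 5) := by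
    intro b c p hab hac hbc hpa hpb hpc
    have hn : [c, a, b, p].Nodup := by
      simp [hab, hac.symm, hbc.symm, hpa.symm, hpb.symm, hpc.symm]
    -- The four distinct points give 4 ≤ N, without which truncated subtraction would break the
    -- identity of the two counts.
    have hcard := card_le_of_nodup hn
    have h := hasPairWalks_path hn
    simp only [List.length_cons, List.length_nil] at hcard
    rw [show 3 + 2 * (Fintype.card α - 4) = 2 * Fintype.card α - 5 by omega] at h
    exact h.congr (by simp [Sym2.eq_swap])
  have star : ∀ {p : α}, p ≠ a → p ≠ b → p ≠ c →
      HasPairWalks [s(a, b), s(a, c), s(a, p)] (2 * Fintype.card α - 5) := by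
    intro p hpa hpb hpc
    have hn : [a, b, c, p].Nodup := by simp [hab, hac, hbc, hpa.symm, hpb.symm, hpc.symm]
    have hcard := card_le_of_nodup hn
    have h := hasPairWalks_star hn
    simp only [List.length_cons, List.length_nil] at hcard
    rwa [show 3 + 2 * (Fintype.card α - 4) = 2 * Fintype.card α - 5 by omega] at h
  have triangle : HasPairWalks [s(a, b), s(a, c), s(b, c)] (2 * Fintype.card α - 5) := by
    have hn : [a, b, c].Nodup := by simp [hab, hac, hbc]
    have hcard := card_le_of_nodup hn
    have h := hasPairWalks_triangle hn
    simp only [List.length_cons, List.length_nil] at hcard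
    rw [show 1 + 2 * (Fintype.card α - 3) = 2 * Fintype.card α - 5 by omega] at h
    exact h.congr (by simp)
  have one : ∀ {p q : α}, p ≠ q → p ≠ a → p ≠ b → p ≠ c → s(p, q) ≠ s(a, b) →
      s(p, q) ≠ s(a, c) →
      HasPairWalks [s(a, b), s(a, c), s(p, q)] (2 * Fintype.card α - 5) := by
    intro p q hpq hpa hpb hpc h1 h2
    by_cases hqa : q = a
    · subst hqa
      rw [Sym2.eq_swap (a := p)]
      exact star hpa hpb hpc
    by_cases hqb : q = b
    · subst hqb
      rw [Sym2.eq_swap (a := p)]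
      exact path hab hac hbc hpa hpb hpc
    by_cases hqc : q = c
    · subst hqc
      exact (path hac hab hbc.symm hpa hpc hpb).congr (by simp [Sym2.eq_swap])
    have hn : [b, a, c, p, q].Nodup := by
      simp [hab.symm, hac, hbc, hpa.symm, hpb.symm, hpc.symm, hpq, Ne.symm hqa, Ne.symm hqb,
        Ne.symm hqc]
    have hcard := card_le_of_nodup hn
    have h := hasPairWalks_path_add_edge hn
    simp only [List.length_cons, List.length_nil] at hcard
    rw [show 5 + 2 * (Fintype.card α - 5) = 2 * Fintype.card α - 5 by omega] at h
    exact h.congr (by simp [Sym2.eq_swap])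
  induction e with
  | _ p q =>
  have hpq : p ≠ q := by simpa using he
  by_cases hp : p ≠ a ∧ p ≠ b ∧ p ≠ c
  · exact one hpq hp.1 hp.2.1 hp.2.2 h1 h2
  by_cases hq : q ≠ a ∧ q ≠ b ∧ q ≠ c
  · rw [Sym2.eq_swap (a := p)]
    exact one hpq.symm hq.1 hq.2.1 hq.2.2 (by rwa [Sym2.eq_swap]) (by rwa [Sym2.eq_swap])
  -- Both ends now lie in {a, b, c}, and the other two pairs are excluded.
  have : s(p, q) = s(b, c) := by
    simp only [ne_eq, Sym2.eq_iff] at h1 h2 ⊢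
    grind
  rw [this]
  exact triangle

/-- Any three edges of a complete graph are joined by `2 N - 5` edge-disjoint walks of its line
graph, where `N` is the number of vertices. -/
theorem hasPairWalks {e₁ e₂ e₃ : Sym2 α} (h₁ : ¬ e₁.IsDiag) (h₂ : ¬ e₂.IsDiag) (h₃ : ¬ e₃.IsDiag)
    (h₁₂ : e₁ ≠ e₂) (h₁₃ : e₁ ≠ e₃) (h₂₃ : e₂ ≠ e₃) :
    HasPairWalks [e₁, e₂, e₃] (2 * Fintype.card α - 5) := by
  have meet : ∀ {e f g : Sym2 α}, ¬ e.IsDiag → ¬ f.IsDiag → ¬ g.IsDiag → e ≠ f → e ≠ g → f ≠ g →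
      (∃ a ∈ e, a ∈ f) → HasPairWalks [e, f, g] (2 * Fintype.card α - 5) := by
    rintro e f g he hf hg hef heg hfg ⟨a, ⟨b, rfl⟩, ⟨c, rfl⟩⟩
    exact hasPairWalks_of_common_end (by simpa using he) (by simpa using hf)
      (by rintro rfl; exact hef rfl) hg heg.symm hfg.symm
  by_cases m₁₂ : ∃ a ∈ e₁, a ∈ e₂
  · exact meet h₁ h₂ h₃ h₁₂ h₁₃ h₂₃ m₁₂
  by_cases m₁₃ : ∃ a ∈ e₁, a ∈ e₃
  · exact (meet h₁ h₃ h₂ h₁₃ h₁₂ h₂₃.symm m₁₃).congr (by simp)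
  by_cases m₂₃ : ∃ a ∈ e₂, a ∈ e₃
  · exact (meet h₂ h₃ h₁ h₂₃ h₁₂.symm h₁₃.symm m₂₃).congr (by simp)
  induction e₁ with
  | _ a b =>
  induction e₂ with
  | _ c d =>
  induction e₃ with
  | _ p q =>
  have hn : [a, b, c, d, p, q].Nodup := by
    simp only [Sym2.mem_iff, not_exists, not_and, forall_eq_or_imp, forall_eq, not_or]
      at m₁₂ m₁₃ m₂₃
    rw [Sym2.mk_isDiag_iff] at h₁ h₂ h₃
    simp only [List.nodup_cons, List.mem_cons, List.not_mem_nil, or_false, not_or, not_false_eq_true,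
      List.nodup_nil, and_true]
    tauto
  have hcard := card_le_of_nodup hn
  have h := hasPairWalks_matching hn
  simp only [List.length_cons, List.length_nil] at hcard
  rwa [show 7 + 2 * (Fintype.card α - 6) = 2 * Fintype.card α - 5 by omega] at h

end Classification

/-! ### The total graph of K_n as the line graph of K_{n+1} -/

section TotalGraph

variable {V : Type*}

/-- The vertices of the total graph of a complete graph as pairs of elements of a set with one
additional element. -/
def totalPair : V ⊕ (completeGraph V).edgeSet → Sym2 (Option V)
  | .inl v => s(none, some v)
  | .inr e => (e : Sym2 V).map some

theorem totalPair_injective : (totalPair (V := V)).Injective := by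
  rintro (u | e) (v | f) h
  · simpa [totalPair] using h
  · have : none ∈ (f : Sym2 V).map some := by
      rw [show (f : Sym2 V).map some = s(none, some u) from h.symm]
      simp
    simp [Sym2.mem_map] at this
  · have : none ∈ (e : Sym2 V).map some := by
      rw [show (e : Sym2 V).map some = s(none, some v) from h]
      simp
    simp [Sym2.mem_map] at this
  · exact congrArg Sum.inr (Subtype.ext (Sym2.map.injective (Option.some_injective V) h))

theorem not_isDiag_totalPair (x : V ⊕ (completeGraph V).edgeSet) : ¬ (totalPair x).IsDiag := by
  rcases x with v | e
  · simp [totalPair]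
  · rw [totalPair, Sym2.isDiag_map (Option.some_injective V)]
    exact (completeGraph V).not_isDiag_of_mem_edgeSet e.2

theorem mem_range_totalPair {p : Sym2 (Option V)} (hp : ¬ p.IsDiag) :
    p ∈ Set.range (totalPair (V := V)) := by
  induction p with
  | _ a b =>
  rcases a with _ | a <;> rcases b with _ | b
  · simp at hp
  · exact ⟨.inl b, rfl⟩
  · exact ⟨.inl a, Sym2.eq_swap⟩
  · exact ⟨.inr ⟨s(a, b), by simpa using hp⟩, rfl⟩

/-- This direction suffices, because walks are only carried back from pairs to the total graph. -/
theorem totalGraph_adj_of_pairGraph_adj {x y : V ⊕ (completeGraph V).edgeSet}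
    (h : (pairGraph (Option V)).Adj (totalPair x) (totalPair y)) :
    (completeGraph V).totalGraph.Adj x y := by
  obtain ⟨hne, a, ha, ha'⟩ := h
  rcases x with u | e <;> rcases y with v | f
  · show u ≠ v
    rintro rfl
    exact hne rfl
  · obtain ⟨b, hb, rfl⟩ := Sym2.mem_map.1 ha'
    have : b = u := by simpa [totalPair] using ha
    exact this ▸ hb
  · obtain ⟨b, hb, rfl⟩ := Sym2.mem_map.1 ha
    have : b = v := by simpa [totalPair] using ha'
    exact this ▸ hb
  · obtain ⟨b, hb, rfl⟩ := Sym2.mem_map.1 ha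
    obtain ⟨c, hc, hcb⟩ := Sym2.mem_map.1 ha'
    obtain rfl := Option.some_injective V hcb
    exact lineGraph_adj_iff_exists.2 ⟨fun h => hne (congrArg _ (congrArg Sum.inr h)), c, hb, hc⟩

theorem totalGraph_completeGraph_hasEdgeDisjointSteinerTrees [Fintype V]
    {S : Finset (V ⊕ (completeGraph V).edgeSet)} (hS : S.card = 3) :
    (completeGraph V).totalGraph.HasEdgeDisjointSteinerTrees S (2 * Fintype.card V - 3) := by
  classical
  obtain ⟨x, y, z, hxy, hxz, hyz, rfl⟩ := Finset.card_eq_three.1 hS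
  obtain ⟨W, hlen, hwalk, hdisj⟩ := hasPairWalks (not_isDiag_totalPair x) (not_isDiag_totalPair y)
    (not_isDiag_totalPair z) (totalPair_injective.ne hxy) (totalPair_injective.ne hxz)
    (totalPair_injective.ne hyz)
  -- The walks visit only non-diagonal pairs, all of which come from vertices of the total graph, so
  -- whole walks can be pulled back.
  have hW : W ∈ Set.range (List.map (List.map (totalPair (V := V)))) := by
    rw [Set.range_list_map]
    intro l hl
    rw [Set.range_list_map]
    exact fun v hv => mem_range_totalPair ((hwalk l hl).2.2 v hv)
  obtain ⟨W, rfl⟩ := hW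
  rw [List.length_map, Fintype.card_option] at hlen
  rw [show 2 * Fintype.card V - 3 = W.length by omega]
  rw [List.pairwise_map] at hdisj
  have hwalk' : ∀ l ∈ W, IsPairWalk [totalPair x, totalPair y, totalPair z] (l.map totalPair) :=
    fun l hl => hwalk _ (List.mem_map_of_mem hl)
  refine hasEdgeDisjointSteinerTrees_of_walks ⟨x, by simp⟩ W ?_ ?_
    (hdisj.imp fun h => (pairDisjoint_map totalPair_injective).1 h)
  · intro l hl
    have := (hwalk' l hl).1
    rw [List.isChain_map] at this
    exact this.imp fun _ _ => totalGraph_adj_of_pairGraph_adj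
  · intro l hl s hs
    have := (hwalk' l hl).2.1 (totalPair s) (by
      simp only [Finset.mem_insert, Finset.mem_singleton] at hs
      rcases hs with rfl | rfl | rfl <;> simp)
    exact (List.mem_map_of_injective totalPair_injective).1 this

/-- A vertex of the complete graph on `n` vertices has at most `2 (n - 1)` neighbours in the total
graph. -/
theorem exists_finset_neighbors_totalGraph_inl [Fintype V] (v : V) :
    ∃ A : Finset (V ⊕ (completeGraph V).edgeSet),
      (∀ w, (completeGraph V).totalGraph.Adj (.inl v) w → w ∈ A) ∧
      A.card ≤ 2 * (Fintype.card V - 1) := by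
  classical
  -- The neighbours of v are the other n - 1 vertices and the n - 1 edges joining v to them.
  let U : Finset V := Finset.univ.erase v
  refine ⟨U.image .inl ∪ U.attach.image fun u : U =>
    .inr ⟨s(v, u), (Finset.ne_of_mem_erase u.2).symm⟩, ?_, ?_⟩
  · rintro (u | ⟨e, he⟩) h
    · have h : v ≠ u := h
      simp [U, h.symm]
    · obtain ⟨u, rfl⟩ : v ∈ e := h
      have h : v ≠ u := he
      exact Finset.mem_union_right _ (Finset.mem_image.2
        ⟨⟨u, by simpa [U] using h.symm⟩, Finset.mem_attach _ _, rfl⟩)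
  · refine (Finset.card_union_le _ _).trans ?_
    have hU : U.card = Fintype.card V - 1 := by simp [U, Finset.card_erase_of_mem]
    have h1 := Finset.card_image_le (s := U) (f := (Sum.inl : V → V ⊕ (completeGraph V).edgeSet))
    have h2 := Finset.card_image_le (s := U.attach)
      (f := fun u : U => (.inr ⟨s(v, u), (Finset.ne_of_mem_erase u.2).symm⟩ :
        V ⊕ (completeGraph V).edgeSet))
    rw [Finset.card_attach] at h2
    omega

theorem totalGraph_completeGraph_localSteinerEdgeConnectivity_le [Fintype V] {u v : V}
    (huv : u ≠ v) {x : V ⊕ (completeGraph V).edgeSet} (hxu : x ≠ .inl u) (hxv : x ≠ .inl v)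
    {S : Finset (V ⊕ (completeGraph V).edgeSet)} (hu : .inl u ∈ S) (hv : .inl v ∈ S)
    (hx : x ∈ S) :
    (completeGraph V).totalGraph.localSteinerEdgeConnectivity S
      ≤ ((2 * Fintype.card V - 3 : ℕ) : ℕ∞) := by
  refine iSup₂_le fun m hm => ?_
  obtain ⟨A, hA, hAc⟩ := exists_finset_neighbors_totalGraph_inl u
  obtain ⟨B, hB, hBc⟩ := exists_finset_neighbors_totalGraph_inl v
  have := hm.lt_of_adj hu hv hx (show u ≠ v from huv) hxu hxv hA hB hAc hBc
  exact Nat.cast_le.2 (by omega)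

end TotalGraph

end SimpleGraph

theorem theorem3p9 (n : ℕ) (hn : 2 ≤ n) :
    (SimpleGraph.completeGraph (Fin n)).totalGraph.generalizedEdgeConnectivity 3
      = ((2 * n - 3 : ℕ) : ℕ∞) := by
  classical
  apply le_antisymm
  · let u : Fin n := ⟨0, by omega⟩
    let v : Fin n := ⟨1, by omega⟩
    have huv : u ≠ v := by simp [u, v]
    -- Taking the edge uv as third element also covers n = 2, where the total graph has no other
    -- vertex.
    let e : (SimpleGraph.completeGraph (Fin n)).edgeSet := ⟨s(u, v), huv⟩
    have h := SimpleGraph.totalGraph_completeGraph_localSteinerEdgeConnectivity_le huv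
      (x := .inr e) (by simp) (by simp) (S := {.inl u, .inl v, .inr e}) (by simp) (by simp)
      (by simp)
    rw [Fintype.card_fin] at h
    refine (iInf₂_le _ ?_).trans h
    exact Finset.card_eq_three.2 ⟨_, _, _, by simpa using huv, by simp, by simp, rfl⟩
  · refine le_iInf₂ fun S hS => ?_
    have h := SimpleGraph.totalGraph_completeGraph_hasEdgeDisjointSteinerTrees hS
    rw [Fintype.card_fin] at h
    exact le_iSup₂_of_le _ h le_rfl
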